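/- Consider the discrete-time system $$x_{k+1}=Ax_k+Bu_k+B_dd_k+B_ww_k+B_w'w_k',\quad e_k=C_ex_k+D_{eu}u_k+D_{ed}d_k,$$ $$z_k=C_zx_k+D_zu_k+D_{zw}'w_k',\quad z_k'=C_z'x_k+D_z'u_k,\quad w_k=\Delta z_k,\quad w_k'=\Delta'(x_k)z_k',\qquad(\ast)$$ with known real matrices $A,B,\dots$ and dimensions $n,m,n_d,n_e,n_w,n_z,n_w',n_z'$ of $x,u,d,e,w,z,w',z'$, where $\Delta\in\mathbb R^{n_w\times n_z}$ is a parametric and $\Delta':\mathbb R^n\to\mathbb R^{n_w'\times n_z'}$ a nonlinear uncertainty. For $\Theta\in\mathbb R^{p\times q}$ and a symmetric $P\in\mathbb R^{(q+p)\times(q+p)}$ write $\mathrm{QC}(\Theta,P)$ for $\begin{bmatrix}\Theta^\top\\ I\end{bmatrix}^\top P\begin{bmatrix}\Theta^\top\\ I\end{bmatrix}\succeq0$. A multiplier class is a convex cone of symmetric matrices which is the projection of the solution set of a strictly feasible linear matrix inequality. Assumption 1. $\mathbf\Delta_{\rm prior}=\{\mathrm{diag}(\Delta_1,\dots,\Delta_\ell)\mid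 \mathrm{QC}(\Delta_j,P_j)\ \forall P_j\in\mathbf P_j,\ j=1,\dots,\ell\}$ with multiplier classes $\mathbf P_j$, each containing an element whose left-upper block (of size $n_{z,j}$) is negative definite, where $\Delta_j\in\mathbb R^{n_{w,j}\times n_{z,j}}$. Assumption 2. $\mathbf D=\{D\in\mathbb R^{n_d\times N}\mid\mathrm{QC}(D,P_d)\ \forall P_d\in\mathbf P_d\}$ with a multiplier class $\mathbf P_d$ containing an element whose left-upper block (of size $N$) is negative definite. Assumption 3. $\mathbf P'$ is a multiplier class; $\Delta'$ is called admissible if $\Delta'(0)=0$ and $\mathrm{QC}(\Delta'(x),P')$ for all $P'\in\mathbf P'$ and $x\in\mathbb R^n$. Data $x_0,\dots,x_N$, $u_0,\dots,u_{N-1}$, $\Delta'_{\rm tr}(x_0),\dots,\Delta'_{\rm tr}(x_{N-1})$ are given, generated by $(\ast)$ for some $\Delta=\Delta_{\rm tr}\in\mathbf\Delta_{\rm prior}$, some admissible $\Delta'=\Delta'_{\rm tr}$ and some disturbance sequence $D_{\rm tr}=[\hat d_0\ \cdots\ \hat d_{N-1}]\in\mathbf D$. Put $X=[x_0\cdots x_{N-1}]$,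 $X_+=[x_1\cdots x_N]$, $U=[u_0\cdots u_{N-1}]$, $W'=[w_0'\cdots w_{N-1}']$ with $w_k'=\Delta'_{\rm tr}(x_k)(C_z'x_k+D_z'u_k)$, and $$M=X_+-AX-BU-B_w'W',\qquad Z=C_zX+D_zU+D_{zw}'W'.$$ Let $\mathbf\Delta_{\rm com}=\{\Delta\in\mathbf\Delta_{\rm prior}\mid M=B_w\Delta Z+B_dD\text{ for some }D\in\mathbf D\}$. With $L_j,R_j$ the $j$-th block columns of the identity in the partitions of $z$ and $w$, and $B_j=B_wR_j$, let $$\tilde{\mathbf P}_{\rm com}=\sum_{j=1}^\ell\begin{bmatrix}L_j^\top&0\\0&B_j^\top\end{bmatrix}^\top\mathbf P_j\begin{bmatrix}L_j^\top&0\\0&B_j^\top\end{bmatrix}+\begin{bmatrix}-Z^\top&M^\top\\0&B_d^\top\end{bmatrix}^\top\mathbf P_d\begin{bmatrix}-Z^\top&M^\top\\0&B_d^\top\end{bmatrix}.$$ Let $P_p=\begin{bmatrix}Q_p&S_p\\S_p^\top&R_p\end{bmatrix}\in\mathbb R^{(n_d+n_e)\times(n_d+n_e)}$ be symmetric and invertible,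 $P_p^{-1}=\begin{bmatrix}\tilde Q_p&\tilde S_p\\\tilde S_p^\top&\tilde R_p\end{bmatrix}$ with $\tilde Q_p\preceq0$, and $\tilde P_p=\begin{bmatrix}-\tilde R_p&\tilde S_p^\top\\\tilde S_p&-\tilde Q_p\end{bmatrix}$. Theorem. Suppose that there exist $\mathcal Y\succ0$, $K\in\mathbb R^{m\times n}$, $\tilde P_{\rm com}\in\tilde{\mathbf P}_{\rm com}$ and $P'\in\mathbf P'$ such that $$\Psi^\top\,\mathrm{diag}\big(-\mathcal Y,\ \mathcal Y,\ P',\ \tilde P_{\rm com},\ \tilde P_p\big)\,\Psi\prec0,$$ $$\Psi=\begin{bmatrix}I&0&0&0\\(A+BK)^\top&(C_z'+D_z'K)^\top&(C_z+D_zK)^\top&(C_e+D_{eu}K)^\top\\0&I&0&0\\{B_w'}^\top&0&{D_{zw}'}^\top&0\\0&0&I&0\\I&0&0&0\\0&0&0&I\\B_d^\top&0&0&D_{ed}^\top\end{bmatrix}.$$ Then the system $(\ast)$ with $u_k=Kx_k$ is (i) robustly stable: there are $c>0$ and $\rho\in[0,1)$ such that for all $\Delta\in\mathbf\Delta_{\rm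 com}$ and all admissible $\Delta'$, every trajectory with $d=0$ satisfies $\|x_k\|_2\le c\rho^k\|x_0\|_2$ for all $k\ge0$; (ii) of robust quadratic performance with index $P_p$: there is $\varepsilon>0$ such that for all $d\in\ell_2$, all $\Delta\in\mathbf\Delta_{\rm com}$ and all admissible $\Delta'$, the trajectory with $x_0=0$ satisfies $$\sum_{k=0}^\infty\begin{bmatrix}d_k\\e_k\end{bmatrix}^\top P_p\begin{bmatrix}d_k\\e_k\end{bmatrix}\le-\varepsilon\sum_{k=0}^\infty d_k^\top d_k,$$ where the series on the left converges. -/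

import Mathlib

open scoped Matrix

noncomputable section

namespace RobustPerf

/-- Index type of a vector that is partitioned into `ℓ` blocks, block `j` having length `k j`. -/
abbrev BlockIdx {ℓ : ℕ} (k : Fin ℓ → ℕ) : Type := Σ j : Fin ℓ, Fin (k j)

/-- The known matrices of the uncertain system
`x⁺ = A x + B u + Bd d + Bw w + Bwp wp`,
`e  = Ce x + Deu u + Ded d`,
`z  = Cz x + Dz u + Dzwp wp`,
`zp = Czp x + Dzp u`.
The suffix `p` stands for a prime: `wp`, `zp` are the signals of the nonlinear channel. -/
structure Plant (n m nd ne nwp nzp : ℕ) {ℓ : ℕ} (nw nz : Fin ℓ → ℕ) where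
  A : Matrix (Fin n) (Fin n) ℝ
  B : Matrix (Fin n) (Fin m) ℝ
  Bd : Matrix (Fin n) (Fin nd) ℝ
  Bw : Matrix (Fin n) (BlockIdx nw) ℝ
  Bwp : Matrix (Fin n) (Fin nwp) ℝ
  Ce : Matrix (Fin ne) (Fin n) ℝ
  Deu : Matrix (Fin ne) (Fin m) ℝ
  Ded : Matrix (Fin ne) (Fin nd) ℝ
  Cz : Matrix (BlockIdx nz) (Fin n) ℝ
  Dz : Matrix (BlockIdx nz) (Fin m) ℝ
  Dzwp : Matrix (BlockIdx nz) (Fin nwp) ℝ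
  Czp : Matrix (Fin nzp) (Fin n) ℝ
  Dzp : Matrix (Fin nzp) (Fin m) ℝ

/-- A state-dependent (nonlinear) uncertainty `x ↦ Δ'(x)`. -/
abbrev NLUncertainty (n nwp nzp : ℕ) : Type :=
  (Fin n → ℝ) → Matrix (Fin nwp) (Fin nzp) ℝ

/-- One time step of the uncertain system with `w = Δ z` and `wp = Δ'(x) zp`:
state `x`, input `u`, disturbance `d`, next state `xnext`, performance output `e`. -/
def Plant.Step {n m nd ne nwp nzp ℓ : ℕ} {nw nz : Fin ℓ → ℕ}
    (G : Plant n m nd ne nwp nzp nw nz)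
    (Δ : Matrix (BlockIdx nw) (BlockIdx nz) ℝ) (Δp : NLUncertainty n nwp nzp)
    (x : Fin n → ℝ) (u : Fin m → ℝ) (d : Fin nd → ℝ)
    (xnext : Fin n → ℝ) (e : Fin ne → ℝ) : Prop :=
  ∃ (w : BlockIdx nw → ℝ) (z : BlockIdx nz → ℝ) (wp : Fin nwp → ℝ) (zp : Fin nzp → ℝ),
    xnext = G.A *ᵥ x + G.B *ᵥ u + G.Bd *ᵥ d + G.Bw *ᵥ w + G.Bwp *ᵥ wp ∧
    e = G.Ce *ᵥ x + G.Deu *ᵥ u + G.Ded *ᵥ d ∧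
    z = G.Cz *ᵥ x + G.Dz *ᵥ u + G.Dzwp *ᵥ wp ∧
    zp = G.Czp *ᵥ x + G.Dzp *ᵥ u ∧
    w = Δ *ᵥ z ∧
    wp = Δp x *ᵥ zp

/-- `(x, d, e)` is a trajectory of the system under the state feedback `u = K x`. -/
def Plant.IsClosedLoop {n m nd ne nwp nzp ℓ : ℕ} {nw nz : Fin ℓ → ℕ}
    (G : Plant n m nd ne nwp nzp nw nz) (K : Matrix (Fin m) (Fin n) ℝ)
    (Δ : Matrix (BlockIdx nw) (BlockIdx nz) ℝ) (Δp : NLUncertainty n nwp nzp)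
    (x : ℕ → Fin n → ℝ) (d : ℕ → Fin nd → ℝ) (e : ℕ → Fin ne → ℝ) : Prop :=
  ∀ k, G.Step Δ Δp (x k) (K *ᵥ x k) (d k) (x (k + 1)) (e k)

/-! ### Multipliers -/

/-- The quadratic constraint `[Δᵀ; I]ᵀ P [Δᵀ; I] ⪰ 0`. -/
def QC {p q : Type*} [Fintype p] [Fintype q] [DecidableEq p]
    (Δ : Matrix p q ℝ) (P : Matrix (q ⊕ p) (q ⊕ p) ℝ) : Prop :=
  ((Matrix.fromRows Δᵀ (1 : Matrix p p ℝ))ᵀ * P *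
    Matrix.fromRows Δᵀ (1 : Matrix p p ℝ)).PosSemidef

/-- `S` is the image under a linear map (a projection) of the solution set of a strictly feasible
linear matrix inequality in `y ∈ ℝ^r`. The LMI may consist of a non-strict part
`F₀ + ∑ yᵢ Fᵢ ⪰ 0` and a strict part `H₀ + ∑ yᵢ Hᵢ ≻ 0`, either of which may be void. -/
def IsLMIRepresentable {ι : Type*} (S : Set (Matrix ι ι ℝ)) : Prop :=
  ∃ (r a b : ℕ)
    (F₀ : Matrix (Fin a) (Fin a) ℝ) (F : Fin r → Matrix (Fin a) (Fin a) ℝ)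
    (H₀ : Matrix (Fin b) (Fin b) ℝ) (H : Fin r → Matrix (Fin b) (Fin b) ℝ)
    (pr : (Fin r → ℝ) →ₗ[ℝ] Matrix ι ι ℝ),
    F₀.IsSymm ∧ (∀ i, (F i).IsSymm) ∧ H₀.IsSymm ∧ (∀ i, (H i).IsSymm) ∧
    (∃ y : Fin r → ℝ, (F₀ + ∑ i, y i • F i).PosDef ∧ (H₀ + ∑ i, y i • H i).PosDef) ∧
    S = pr '' {y | (F₀ + ∑ i, y i • F i).PosSemidef ∧ (H₀ + ∑ i, y i • H i).PosDef}

/-- A convex cone of symmetric matrices that admits an LMI representation. -/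
def IsMultiplierClass {ι : Type*} (C : ConvexCone ℝ (Matrix ι ι ℝ)) : Prop :=
  (∀ P ∈ C, P.IsSymm) ∧ IsLMIRepresentable (C : Set (Matrix ι ι ℝ))

/-- Some multiplier of the class has a negative definite left-upper block. -/
def HasNegDefBlock {p q : Type*} (C : ConvexCone ℝ (Matrix (q ⊕ p) (q ⊕ p) ℝ)) : Prop :=
  ∃ P ∈ C, (-P.toBlocks₁₁).PosDef

/-- The set of all `Δ = diag(Δ₁, …, Δ_ℓ)` whose blocks satisfy the quadratic constraints of the
given classes. -/
def DeltaPrior {ℓ : ℕ} {nw nz : Fin ℓ → ℕ}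
    (Pj : ∀ j : Fin ℓ, ConvexCone ℝ (Matrix (Fin (nz j) ⊕ Fin (nw j)) (Fin (nz j) ⊕ Fin (nw j)) ℝ)) :
    Set (Matrix (BlockIdx nw) (BlockIdx nz) ℝ) :=
  {Δ | ∃ Δj : ∀ j : Fin ℓ, Matrix (Fin (nw j)) (Fin (nz j)) ℝ,
    Δ = Matrix.blockDiagonal' Δj ∧ ∀ j, ∀ P ∈ Pj j, QC (Δj j) P}

/-- The set of disturbance matrices `D = [d₀ … d_{N-1}]` described by the class `Pd`. -/
def DisturbanceSet {nd N : ℕ} (Pd : ConvexCone ℝ (Matrix (Fin N ⊕ Fin nd) (Fin N ⊕ Fin nd) ℝ)) :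
    Set (Matrix (Fin nd) (Fin N) ℝ) :=
  {D | ∀ P ∈ Pd, QC D P}

/-- The nonlinear uncertainties with `Δ'(0) = 0` that are described by the class `Pp`. -/
def NLSet (n : ℕ) {nwp nzp : ℕ}
    (Pp : ConvexCone ℝ (Matrix (Fin nzp ⊕ Fin nwp) (Fin nzp ⊕ Fin nwp) ℝ)) :
    Set (NLUncertainty n nwp nzp) :=
  {Δp | Δp 0 = 0 ∧ ∀ P ∈ Pp, ∀ x, QC (Δp x) P}

/-! ### Data and learnt uncertainties -/

/-- Measured data: states `x₀, …, x_N`, inputs `u₀, …, u_{N-1}`, and the values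
`Δ'(x₀), …, Δ'(x_{N-1})` of the nonlinear uncertainty. -/
structure Data (n m nwp nzp N : ℕ) where
  x : Fin (N + 1) → Fin n → ℝ
  u : Fin N → Fin m → ℝ
  nl : Fin N → Matrix (Fin nwp) (Fin nzp) ℝ

/-- The data are generated by the system with uncertainties `Δtr`, `Δptr` and with the columns of
`Dtr` as disturbance sequence. -/
def Data.GeneratedBy {n m nd ne nwp nzp ℓ N : ℕ} {nw nz : Fin ℓ → ℕ}
    (𝒟 : Data n m nwp nzp N) (G : Plant n m nd ne nwp nzp nw nz)
    (Δtr : Matrix (BlockIdx nw) (BlockIdx nz) ℝ) (Δptr : NLUncertainty n nwp nzp)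
    (Dtr : Matrix (Fin nd) (Fin N) ℝ) : Prop :=
  ∀ k : Fin N, 𝒟.nl k = Δptr (𝒟.x k.castSucc) ∧
    ∃ e, G.Step Δtr Δptr (𝒟.x k.castSucc) (𝒟.u k) (fun i => Dtr i k) (𝒟.x k.succ) e

/-- `X = [x₀ … x_{N-1}]`. -/
def Data.X {n m nwp nzp N : ℕ} (𝒟 : Data n m nwp nzp N) : Matrix (Fin n) (Fin N) ℝ :=
  Matrix.of fun i k => 𝒟.x k.castSucc i

/-- `X₊ = [x₁ … x_N]`. -/
def Data.Xplus {n m nwp nzp N : ℕ} (𝒟 : Data n m nwp nzp N) : Matrix (Fin n) (Fin N) ℝ :=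
  Matrix.of fun i k => 𝒟.x k.succ i

/-- `U = [u₀ … u_{N-1}]`. -/
def Data.U {n m nwp nzp N : ℕ} (𝒟 : Data n m nwp nzp N) : Matrix (Fin m) (Fin N) ℝ :=
  Matrix.of fun i k => 𝒟.u k i

section DataMatrices

variable {n m nd ne nwp nzp ℓ N : ℕ} {nw nz : Fin ℓ → ℕ}

/-- `W' = [w'₀ … w'_{N-1}]` with `w'ₖ = Δ'(xₖ) (Cz' xₖ + Dz' uₖ)`. -/
def Plant.Wp (G : Plant n m nd ne nwp nzp nw nz) (𝒟 : Data n m nwp nzp N) :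
    Matrix (Fin nwp) (Fin N) ℝ :=
  Matrix.of fun i k => (𝒟.nl k *ᵥ (G.Czp *ᵥ 𝒟.x k.castSucc + G.Dzp *ᵥ 𝒟.u k)) i

/-- `M = X₊ - A X - B U - Bw' W'`. -/
def Plant.M (G : Plant n m nd ne nwp nzp nw nz) (𝒟 : Data n m nwp nzp N) :
    Matrix (Fin n) (Fin N) ℝ :=
  𝒟.Xplus - G.A * 𝒟.X - G.B * 𝒟.U - G.Bwp * G.Wp 𝒟

/-- `Z = Cz X + Dz U + Dzw' W'`. -/
def Plant.Z (G : Plant n m nd ne nwp nzp nw nz) (𝒟 : Data n m nwp nzp N) :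
    Matrix (BlockIdx nz) (Fin N) ℝ :=
  G.Cz * 𝒟.X + G.Dz * 𝒟.U + G.Dzwp * G.Wp 𝒟

/-- The uncertainties consistent with the data and some disturbance in the set given by `Pd`. -/
def DeltaLearnt (G : Plant n m nd ne nwp nzp nw nz) (𝒟 : Data n m nwp nzp N)
    (Pd : ConvexCone ℝ (Matrix (Fin N ⊕ Fin nd) (Fin N ⊕ Fin nd) ℝ)) :
    Set (Matrix (BlockIdx nw) (BlockIdx nz) ℝ) :=
  {Δ | ∃ D ∈ DisturbanceSet Pd, G.M 𝒟 = G.Bw * Δ * G.Z 𝒟 + G.Bd * D}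

/-- The combined uncertainty set. -/
def DeltaCom (G : Plant n m nd ne nwp nzp nw nz) (𝒟 : Data n m nwp nzp N)
    (Pj : ∀ j : Fin ℓ, ConvexCone ℝ (Matrix (Fin (nz j) ⊕ Fin (nw j)) (Fin (nz j) ⊕ Fin (nw j)) ℝ))
    (Pd : ConvexCone ℝ (Matrix (Fin N ⊕ Fin nd) (Fin N ⊕ Fin nd) ℝ)) :
    Set (Matrix (BlockIdx nw) (BlockIdx nz) ℝ) :=
  DeltaPrior Pj ∩ DeltaLearnt G 𝒟 Pd

/-- The `j`-th block column of the identity matrix. -/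
def blockCol (k : Fin ℓ → ℕ) (j : Fin ℓ) : Matrix (BlockIdx k) (Fin (k j)) ℝ :=
  (1 : Matrix (BlockIdx k) (BlockIdx k) ℝ).submatrix id (fun i => ⟨j, i⟩)

/-- `[Lⱼᵀ 0; 0 Bⱼᵀ]` with `Lⱼ`, `Rⱼ` block columns of the identity and `Bⱼ = Bw Rⱼ`. -/
def Plant.priorFactor (G : Plant n m nd ne nwp nzp nw nz) (j : Fin ℓ) :
    Matrix (Fin (nz j) ⊕ Fin (nw j)) (BlockIdx nz ⊕ Fin n) ℝ :=
  Matrix.fromBlocks (blockCol nz j)ᵀ 0 0 (G.Bw * blockCol nw j)ᵀ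

/-- `[-Zᵀ Mᵀ; 0 Bdᵀ]`. -/
def Plant.dataFactor (G : Plant n m nd ne nwp nzp nw nz) (𝒟 : Data n m nwp nzp N) :
    Matrix (Fin N ⊕ Fin nd) (BlockIdx nz ⊕ Fin n) ℝ :=
  Matrix.fromBlocks (-(G.Z 𝒟)ᵀ) (G.M 𝒟)ᵀ 0 G.Bdᵀ

/-- The transformed prior multipliers `∑ⱼ [Lⱼᵀ 0; 0 Bⱼᵀ]ᵀ 𝐏ⱼ [Lⱼᵀ 0; 0 Bⱼᵀ]`. -/
def PriorMultipliers (G : Plant n m nd ne nwp nzp nw nz)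
    (Pj : ∀ j : Fin ℓ, ConvexCone ℝ (Matrix (Fin (nz j) ⊕ Fin (nw j)) (Fin (nz j) ⊕ Fin (nw j)) ℝ)) :
    Set (Matrix (BlockIdx nz ⊕ Fin n) (BlockIdx nz ⊕ Fin n) ℝ) :=
  {Q | ∃ P : ∀ j : Fin ℓ, Matrix (Fin (nz j) ⊕ Fin (nw j)) (Fin (nz j) ⊕ Fin (nw j)) ℝ,
    (∀ j, P j ∈ Pj j) ∧ Q = ∑ j, (G.priorFactor j)ᵀ * P j * G.priorFactor j}

/-- The multipliers learnt from data, `[-Zᵀ Mᵀ; 0 Bdᵀ]ᵀ 𝐏_d [-Zᵀ Mᵀ; 0 Bdᵀ]`. -/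
def LearntMultipliers (G : Plant n m nd ne nwp nzp nw nz) (𝒟 : Data n m nwp nzp N)
    (Pd : ConvexCone ℝ (Matrix (Fin N ⊕ Fin nd) (Fin N ⊕ Fin nd) ℝ)) :
    Set (Matrix (BlockIdx nz ⊕ Fin n) (BlockIdx nz ⊕ Fin n) ℝ) :=
  {Q | ∃ P ∈ Pd, Q = (G.dataFactor 𝒟)ᵀ * P * G.dataFactor 𝒟}

/-- The combined multipliers: sums of a prior multiplier and a learnt multiplier. -/
def CombinedMultipliers (G : Plant n m nd ne nwp nzp nw nz) (𝒟 : Data n m nwp nzp N)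
    (Pj : ∀ j : Fin ℓ, ConvexCone ℝ (Matrix (Fin (nz j) ⊕ Fin (nw j)) (Fin (nz j) ⊕ Fin (nw j)) ℝ))
    (Pd : ConvexCone ℝ (Matrix (Fin N ⊕ Fin nd) (Fin N ⊕ Fin nd) ℝ)) :
    Set (Matrix (BlockIdx nz ⊕ Fin n) (BlockIdx nz ⊕ Fin n) ℝ) :=
  {Q | ∃ Q₁ ∈ PriorMultipliers G Pj, ∃ Q₂ ∈ LearntMultipliers G 𝒟 Pd, Q = Q₁ + Q₂}

end DataMatrices

/-! ### The synthesis inequality -/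

/-- `P̃_p = [-R̃ S̃ᵀ; S̃ -Q̃]` where `[Q̃ S̃; S̃ᵀ R̃] = P_p⁻¹`. -/
def dualIndex {nd ne : ℕ} (Pp : Matrix (Fin nd ⊕ Fin ne) (Fin nd ⊕ Fin ne) ℝ) :
    Matrix (Fin ne ⊕ Fin nd) (Fin ne ⊕ Fin nd) ℝ :=
  Matrix.fromBlocks (-(Pp⁻¹).toBlocks₂₂) ((Pp⁻¹).toBlocks₁₂)ᵀ
    (Pp⁻¹).toBlocks₁₂ (-(Pp⁻¹).toBlocks₁₁)

/-- The block row `[a b c d]`. -/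
def row4 {r c₁ c₂ c₃ c₄ : Type*} (a : Matrix r c₁ ℝ) (b : Matrix r c₂ ℝ) (c : Matrix r c₃ ℝ)
    (d : Matrix r c₄ ℝ) : Matrix r (((c₁ ⊕ c₂) ⊕ c₃) ⊕ c₄) ℝ :=
  Matrix.fromCols (Matrix.fromCols (Matrix.fromCols a b) c) d

/-- The block diagonal matrix `diag(a, b)`. -/
def diag2 {r s : Type*} (a : Matrix r r ℝ) (b : Matrix s s ℝ) : Matrix (r ⊕ s) (r ⊕ s) ℝ :=
  Matrix.fromBlocks a 0 0 b

section Synthesis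

variable {n m nd ne nwp nzp ℓ : ℕ} {nw nz : Fin ℓ → ℕ}

/-- The outer factor of the synthesis inequality; its block columns have the dimensions
`n, nz', nz, ne` and its block rows `n, n | nz', nw' | nz, n | ne, nd`. -/
def Plant.outer (G : Plant n m nd ne nwp nzp nw nz) (K : Matrix (Fin m) (Fin n) ℝ) :
    Matrix ((((Fin n ⊕ Fin n) ⊕ (Fin nzp ⊕ Fin nwp)) ⊕ (BlockIdx nz ⊕ Fin n)) ⊕
        (Fin ne ⊕ Fin nd))
      (((Fin n ⊕ Fin nzp) ⊕ BlockIdx nz) ⊕ Fin ne) ℝ :=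
  Matrix.fromRows
    (Matrix.fromRows
      (Matrix.fromRows
        (Matrix.fromRows
          (row4 1 0 0 0)
          (row4 (G.A + G.B * K)ᵀ (G.Czp + G.Dzp * K)ᵀ (G.Cz + G.Dz * K)ᵀ (G.Ce + G.Deu * K)ᵀ))
        (Matrix.fromRows
          (row4 0 1 0 0)
          (row4 G.Bwpᵀ 0 G.Dzwpᵀ 0)))
      (Matrix.fromRows
        (row4 0 0 1 0)
        (row4 1 0 0 0)))
    (Matrix.fromRows
      (row4 0 0 0 1)
      (row4 G.Bdᵀ 0 0 G.Dedᵀ))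

/-- The synthesis inequality `Ψᵀ diag(diag(-Y, Y), P', P̃_com, P̃_p) Ψ ≺ 0`. -/
def Plant.SynthesisLMI (G : Plant n m nd ne nwp nzp nw nz) (K : Matrix (Fin m) (Fin n) ℝ)
    (Y : Matrix (Fin n) (Fin n) ℝ)
    (Pnl : Matrix (Fin nzp ⊕ Fin nwp) (Fin nzp ⊕ Fin nwp) ℝ)
    (Pcom : Matrix (BlockIdx nz ⊕ Fin n) (BlockIdx nz ⊕ Fin n) ℝ)
    (Pp : Matrix (Fin nd ⊕ Fin ne) (Fin nd ⊕ Fin ne) ℝ) : Prop :=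
  (-((G.outer K)ᵀ * diag2 (diag2 (diag2 (diag2 (-Y) Y) Pnl) Pcom) (dualIndex Pp) *
    G.outer K)).PosDef

/-! ### Robust stability and performance -/

/-- Uniform global exponential stability, for `d = 0`, of the closed loop with `u = K x`, over all
uncertainties in the given sets. -/
def Plant.RobustlyStable (G : Plant n m nd ne nwp nzp nw nz) (K : Matrix (Fin m) (Fin n) ℝ)
    (DΔ : Set (Matrix (BlockIdx nw) (BlockIdx nz) ℝ)) (DΔp : Set (NLUncertainty n nwp nzp)) :
    Prop :=
  ∃ C ρ : ℝ, 0 < C ∧ 0 ≤ ρ ∧ ρ < 1 ∧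
    ∀ Δ ∈ DΔ, ∀ Δp ∈ DΔp, ∀ (x : ℕ → Fin n → ℝ) (e : ℕ → Fin ne → ℝ),
      G.IsClosedLoop K Δ Δp x 0 e →
        ∀ k, ‖WithLp.toLp 2 (x k)‖ ≤ C * ρ ^ k * ‖WithLp.toLp 2 (x 0)‖

/-- The supply rate `[d; e]ᵀ P_p [d; e]`. -/
def supply {nd ne : ℕ} (Pp : Matrix (Fin nd ⊕ Fin ne) (Fin nd ⊕ Fin ne) ℝ)
    (d : Fin nd → ℝ) (e : Fin ne → ℝ) : ℝ :=
  Sum.elim d e ⬝ᵥ (Pp *ᵥ Sum.elim d e)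

/-- Robust quadratic performance with index `P_p`, for zero initial state: there is `ε > 0` with
`∑ₖ [dₖ; eₖ]ᵀ P_p [dₖ; eₖ] ≤ -ε ∑ₖ dₖᵀ dₖ` (the left series being convergent) for all `d ∈ ℓ₂`
and all uncertainties in the given sets. -/
def Plant.RobustQuadPerf (G : Plant n m nd ne nwp nzp nw nz) (K : Matrix (Fin m) (Fin n) ℝ)
    (DΔ : Set (Matrix (BlockIdx nw) (BlockIdx nz) ℝ)) (DΔp : Set (NLUncertainty n nwp nzp))
    (Pp : Matrix (Fin nd ⊕ Fin ne) (Fin nd ⊕ Fin ne) ℝ) : Prop :=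
  ∃ ε : ℝ, 0 < ε ∧
    ∀ d : ℕ → Fin nd → ℝ, (Summable fun k => d k ⬝ᵥ d k) →
      ∀ Δ ∈ DΔ, ∀ Δp ∈ DΔp, ∀ (x : ℕ → Fin n → ℝ) (e : ℕ → Fin ne → ℝ),
        G.IsClosedLoop K Δ Δp x d e → x 0 = 0 →
          (Summable fun k => supply Pp (d k) (e k)) ∧
            ∑' k, supply Pp (d k) (e k) ≤ -ε * ∑' k, d k ⬝ᵥ d k

end Synthesis

end RobustPerf

end

/-! Write `V x = xᵀ Y⁻¹ x`. The synthesis inequality is a dissipation inequality for the transposed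
closed loop, and completing squares turns it into one for the loop itself with storage function `V`.

Freeze one time step. Test the inequality at a dual state `ξ` and dual input `v`, and let the other
two components be the responses of the transposed uncertainties. Both multiplier terms are then
nonnegative (`CombinedMultipliers.nonneg` and the constraint on `Δ'(x)`) and drop out. This leaves
`DualDissipation`, whose margin `α` comes from the inequality alone and so is uniform over all
uncertainties.

The dual successor `ζ` pairs with the primal step by `ζ·x + q·d = ξ·x' + v·e`, where `q = Bdᵀ ξ +
Dedᵀ v`. Take `ξ = Y⁻¹ x'` and use `(ζ - Y⁻¹ x)ᵀ Y (ζ - Y⁻¹ x) ≥ 0`. With `v = 0` this gives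
geometric decay of `V` up to a multiple of `|d|²` (`exists_storage_decay`). With `v` the `e`-part of
`P_p [d; e]` it gives the strict dissipation inequality with supply rate `P_p`
(`exists_dissipation`). The sign of `Q̃_p` is needed in both. Iterating the first gives stability
and square summability of the state; telescoping the second gives performance. -/

namespace RobustPerf

/-! ### Bounds for quadratic forms -/

section QuadraticForms

variable {ι κ : Type*} [Fintype ι] [Fintype κ]

theorem mulVec_dotProduct_eq (M : Matrix ι κ ℝ) (v : κ → ℝ) (w : ι → ℝ) :
    (M *ᵥ v) ⬝ᵥ w = v ⬝ᵥ (Mᵀ *ᵥ w) := by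
  rw [Matrix.mulVec_transpose, dotProduct_comm, Matrix.dotProduct_mulVec, dotProduct_comm]

theorem dotProduct_self_nonneg (v : ι → ℝ) : 0 ≤ v ⬝ᵥ v :=
  Finset.sum_nonneg fun i _ => mul_self_nonneg (v i)

theorem abs_dotProduct_le (v w : ι → ℝ) : |v ⬝ᵥ w| ≤ (v ⬝ᵥ v + w ⬝ᵥ w) / 2 := by
  have h1 := dotProduct_self_nonneg (v - w)
  have h2 := dotProduct_self_nonneg (v + w)
  simp only [sub_dotProduct, dotProduct_sub, add_dotProduct, dotProduct_add,
    dotProduct_comm w v] at h1 h2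
  rw [abs_le]
  constructor <;> linarith

theorem dotProduct_self_add_le (v w : ι → ℝ) :
    (v + w) ⬝ᵥ (v + w) ≤ 2 * (v ⬝ᵥ v + w ⬝ᵥ w) := by
  have := (abs_le.1 (abs_dotProduct_le v w)).2
  simp only [add_dotProduct, dotProduct_add, dotProduct_comm w v]
  linarith

theorem exists_mulVec_sq_le (M : Matrix ι κ ℝ) :
    ∃ c, 0 < c ∧ ∀ v, (M *ᵥ v) ⬝ᵥ (M *ᵥ v) ≤ c * (v ⬝ᵥ v) := by
  have h0 : 0 ≤ ∑ i, ∑ j, M i j ^ 2 :=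
    Finset.sum_nonneg fun i _ => Finset.sum_nonneg fun j _ => sq_nonneg _
  -- The squared Frobenius norm works by Cauchy–Schwarz; adding 1 keeps the constant positive when
  -- `M = 0`.
  refine ⟨(∑ i, ∑ j, M i j ^ 2) + 1, by linarith, fun v => ?_⟩
  have h : (M *ᵥ v) ⬝ᵥ (M *ᵥ v) ≤ (∑ i, ∑ j, M i j ^ 2) * (v ⬝ᵥ v) := by
    rw [Finset.sum_mul]
    refine Finset.sum_le_sum fun i _ => ?_
    have := Finset.sum_mul_sq_le_sq_mul_sq Finset.univ (M i) v
    simpa [dotProduct, Matrix.mulVec, pow_two] using this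
  nlinarith [dotProduct_self_nonneg v]

theorem exists_abs_quadForm_le (M : Matrix ι ι ℝ) :
    ∃ c, 0 < c ∧ ∀ v, |v ⬝ᵥ (M *ᵥ v)| ≤ c * (v ⬝ᵥ v) := by
  obtain ⟨c, hc, h⟩ := exists_mulVec_sq_le M
  refine ⟨(1 + c) / 2, by linarith, fun v => (abs_dotProduct_le _ _).trans ?_⟩
  linarith [h v]

theorem posSemidef_quadForm_nonneg {M : Matrix ι ι ℝ} (hM : M.PosSemidef) (v : ι → ℝ) :
    0 ≤ v ⬝ᵥ (M *ᵥ v) := by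
  simpa using hM.dotProduct_mulVec_nonneg v

-- Factor `M = Bᵀ B`: then `M v = Bᵀ (B v)`, while the form at `v` is `|B v|²`. For singular `M`
-- this replaces coercivity, and it is applied to `-Q̃_p`.
open scoped MatrixOrder in
theorem exists_mulVec_sq_le_quadForm {M : Matrix ι ι ℝ} (hM : M.PosSemidef) :
    ∃ c, 0 < c ∧ ∀ v, (M *ᵥ v) ⬝ᵥ (M *ᵥ v) ≤ c * (v ⬝ᵥ (M *ᵥ v)) := by
  classical
  obtain ⟨B, rfl⟩ : ∃ B : Matrix ι ι ℝ, M = Bᵀ * B := by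
    obtain ⟨B, hB⟩ := CStarAlgebra.nonneg_iff_eq_star_mul_self.1 hM.nonneg
    exact ⟨B, by simpa [Matrix.star_eq_conjTranspose] using hB⟩
  obtain ⟨c, hc, h⟩ := exists_mulVec_sq_le Bᵀ
  refine ⟨c, hc, fun v => ?_⟩
  have := h (B *ᵥ v)
  rwa [mulVec_dotProduct_eq B, Matrix.mulVec_mulVec] at this

theorem exists_le_quadForm [DecidableEq ι] {M : Matrix ι ι ℝ} (hM : M.PosDef) :
    ∃ α, 0 < α ∧ ∀ v, α * (v ⬝ᵥ v) ≤ v ⬝ᵥ (M *ᵥ v) := by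
  obtain ⟨c, hc, h⟩ := exists_mulVec_sq_le_quadForm hM.posSemidef
  obtain ⟨b, hb, h'⟩ := exists_mulVec_sq_le M⁻¹
  refine ⟨(b * c)⁻¹, by positivity, fun v => ?_⟩
  have h1 := h' (M *ᵥ v)
  rw [Matrix.mulVec_mulVec, Matrix.nonsing_inv_mul _ ((Matrix.isUnit_iff_isUnit_det _).1 hM.isUnit),
    Matrix.one_mulVec] at h1
  rw [inv_mul_le_iff₀ (by positivity)]
  nlinarith [h v]

theorem symm_dotProduct_mulVec_comm {M : Matrix ι ι ℝ} (hM : M.IsSymm) (v w : ι → ℝ) :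
    v ⬝ᵥ (M *ᵥ w) = w ⬝ᵥ (M *ᵥ v) := by
  rw [dotProduct_comm, mulVec_dotProduct_eq, hM.eq]

theorem quadForm_conj (F : Matrix κ ι ℝ) (P : Matrix κ κ ℝ) (v : ι → ℝ) :
    v ⬝ᵥ ((Fᵀ * P * F) *ᵥ v) = (F *ᵥ v) ⬝ᵥ (P *ᵥ (F *ᵥ v)) := by
  rw [mulVec_dotProduct_eq, Matrix.mulVec_mulVec, Matrix.mulVec_mulVec, Matrix.mul_assoc]

theorem quadForm_fromBlocks (A : Matrix ι ι ℝ) (B : Matrix ι κ ℝ) (C : Matrix κ ι ℝ)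
    (D : Matrix κ κ ℝ) (v : ι → ℝ) (w : κ → ℝ) :
    Sum.elim v w ⬝ᵥ (Matrix.fromBlocks A B C D *ᵥ Sum.elim v w) =
      v ⬝ᵥ (A *ᵥ v) + v ⬝ᵥ (B *ᵥ w) + w ⬝ᵥ (C *ᵥ v) + w ⬝ᵥ (D *ᵥ w) := by
  rw [Matrix.fromBlocks_mulVec, sumElim_dotProduct_sumElim]
  simp only [Sum.elim_comp_inl, Sum.elim_comp_inr, dotProduct_add]
  ring

theorem quadForm_diag2 (A : Matrix ι ι ℝ) (D : Matrix κ κ ℝ) (v : ι → ℝ) (w : κ → ℝ) :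
    Sum.elim v w ⬝ᵥ (diag2 A D *ᵥ Sum.elim v w) = v ⬝ᵥ (A *ᵥ v) + w ⬝ᵥ (D *ᵥ w) := by
  rw [diag2, quadForm_fromBlocks]
  simp

end QuadraticForms

section QC

theorem QC.nonneg {p q : Type*} [Fintype p] [Fintype q] [DecidableEq p] {Δ : Matrix p q ℝ}
    {P : Matrix (q ⊕ p) (q ⊕ p) ℝ} (h : QC Δ P) (v : p → ℝ) :
    0 ≤ Sum.elim (Δᵀ *ᵥ v) v ⬝ᵥ (P *ᵥ Sum.elim (Δᵀ *ᵥ v) v) := by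
  have := posSemidef_quadForm_nonneg h v
  rwa [quadForm_conj, Matrix.fromRows_mulVec, Matrix.one_mulVec] at this

end QC

theorem row4_mulVec {r c₁ c₂ c₃ c₄ : Type*} [Fintype c₁] [Fintype c₂] [Fintype c₃] [Fintype c₄]
    (a : Matrix r c₁ ℝ) (b : Matrix r c₂ ℝ) (c : Matrix r c₃ ℝ) (d : Matrix r c₄ ℝ)
    (v₁ : c₁ → ℝ) (v₂ : c₂ → ℝ) (v₃ : c₃ → ℝ) (v₄ : c₄ → ℝ) :
    row4 a b c d *ᵥ Sum.elim (Sum.elim (Sum.elim v₁ v₂) v₃) v₄ =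
      a *ᵥ v₁ + b *ᵥ v₂ + c *ᵥ v₃ + d *ᵥ v₄ := by
  simp only [row4, Matrix.fromCols_mulVec_sumElim]

/-! ### The synthesis inequality and the validity of its multipliers -/

section Synthesis

variable {n m nd ne nwp nzp ℓ N : ℕ} {nw nz : Fin ℓ → ℕ}

/-- The swap with sign change `(v, q) ↦ (q, -v)` carries the dual index to `-P_p⁻¹`. -/
theorem quadForm_dualIndex {Pp : Matrix (Fin nd ⊕ Fin ne) (Fin nd ⊕ Fin ne) ℝ}
    (v : Fin ne → ℝ) (q : Fin nd → ℝ) (hPp : Pp.IsSymm) :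
    Sum.elim v q ⬝ᵥ (dualIndex Pp *ᵥ Sum.elim v q) =
      -(Sum.elim q (-v) ⬝ᵥ (Pp⁻¹ *ᵥ Sum.elim q (-v))) := by
  have hs : (Pp⁻¹)ᵀ = Pp⁻¹ := by rw [Matrix.transpose_nonsing_inv, hPp.eq]
  have h21 : (Pp⁻¹).toBlocks₂₁ = ((Pp⁻¹).toBlocks₁₂)ᵀ := by
    conv_lhs => rw [← hs]
    rfl
  conv_rhs => rw [← Matrix.fromBlocks_toBlocks Pp⁻¹]
  rw [dualIndex, quadForm_fromBlocks, quadForm_fromBlocks, h21]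
  simp only [Matrix.neg_mulVec, Matrix.mulVec_neg, dotProduct_neg, neg_dotProduct]
  ring

/-- The synthesis inequality evaluated at a vector, with a uniform margin. -/
theorem Plant.SynthesisLMI.exists_margin {G : Plant n m nd ne nwp nzp nw nz}
    {K : Matrix (Fin m) (Fin n) ℝ} {Y : Matrix (Fin n) (Fin n) ℝ}
    {Pnl : Matrix (Fin nzp ⊕ Fin nwp) (Fin nzp ⊕ Fin nwp) ℝ}
    {Pcom : Matrix (BlockIdx nz ⊕ Fin n) (BlockIdx nz ⊕ Fin n) ℝ}
    {Pp : Matrix (Fin nd ⊕ Fin ne) (Fin nd ⊕ Fin ne) ℝ}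
    (h : G.SynthesisLMI K Y Pnl Pcom Pp) :
    ∃ α, 0 < α ∧ ∀ (ξ : Fin n → ℝ) (η' : Fin nzp → ℝ) (η : BlockIdx nz → ℝ) (v : Fin ne → ℝ)
      (ζ : Fin n → ℝ) (μ : Fin nwp → ℝ) (q : Fin nd → ℝ),
      ζ = (G.A + G.B * K)ᵀ *ᵥ ξ + (G.Czp + G.Dzp * K)ᵀ *ᵥ η' + (G.Cz + G.Dz * K)ᵀ *ᵥ η +
        (G.Ce + G.Deu * K)ᵀ *ᵥ v →
      μ = G.Bwpᵀ *ᵥ ξ + G.Dzwpᵀ *ᵥ η →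
      q = G.Bdᵀ *ᵥ ξ + G.Dedᵀ *ᵥ v →
      -(ξ ⬝ᵥ (Y *ᵥ ξ)) + ζ ⬝ᵥ (Y *ᵥ ζ) + Sum.elim η' μ ⬝ᵥ (Pnl *ᵥ Sum.elim η' μ) +
        Sum.elim η ξ ⬝ᵥ (Pcom *ᵥ Sum.elim η ξ) +
        Sum.elim v q ⬝ᵥ (dualIndex Pp *ᵥ Sum.elim v q) ≤ -α * (ξ ⬝ᵥ ξ + v ⬝ᵥ v) := by
  obtain ⟨α, hα, hle⟩ := exists_le_quadForm h
  refine ⟨α, hα, ?_⟩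
  rintro ξ η' η v ζ μ q rfl rfl rfl
  have := hle (Sum.elim (Sum.elim (Sum.elim ξ η') η) v)
  rw [Matrix.neg_mulVec, dotProduct_neg, quadForm_conj] at this
  simp only [Plant.outer, Matrix.fromRows_mulVec, row4_mulVec, Matrix.one_mulVec,
    Matrix.zero_mulVec, add_zero, zero_add, quadForm_diag2, Matrix.neg_mulVec, dotProduct_neg,
    sumElim_dotProduct_sumElim] at this
  -- The margin covers all four components; the shares of `η'` and `η` are discarded.
  nlinarith [dotProduct_self_nonneg η', dotProduct_self_nonneg η]

theorem blockCol_transpose_mul {k l : Fin ℓ → ℕ} (Δj : ∀ j, Matrix (Fin (k j)) (Fin (l j)) ℝ)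
    (j : Fin ℓ) :
    (blockCol l j)ᵀ * (Matrix.blockDiagonal' Δj)ᵀ = (Δj j)ᵀ * (blockCol k j)ᵀ := by
  ext a ⟨i, b⟩
  simp only [Matrix.mul_apply, Matrix.transpose_apply, blockCol, Matrix.submatrix_apply, id,
    Matrix.one_apply, ite_mul, one_mul, zero_mul, mul_ite, mul_one, mul_zero, Finset.sum_ite_eq', Finset.mem_univ, if_true]
  by_cases hij : i = j
  · subst hij
    simp [Matrix.blockDiagonal'_apply_eq]
  · rw [Matrix.blockDiagonal'_apply_ne _ _ _ hij]
    refine (Finset.sum_eq_zero fun c _ => if_neg fun h => hij ?_).symm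
    exact congrArg Sigma.fst h

/-- Every combined multiplier is valid for every uncertainty consistent with prior knowledge and
data. -/
theorem CombinedMultipliers.nonneg {G : Plant n m nd ne nwp nzp nw nz} {𝒟 : Data n m nwp nzp N}
    {Pj : ∀ j : Fin ℓ,
      ConvexCone ℝ (Matrix (Fin (nz j) ⊕ Fin (nw j)) (Fin (nz j) ⊕ Fin (nw j)) ℝ)}
    {Pd : ConvexCone ℝ (Matrix (Fin N ⊕ Fin nd) (Fin N ⊕ Fin nd) ℝ)}
    {Pcom : Matrix (BlockIdx nz ⊕ Fin n) (BlockIdx nz ⊕ Fin n) ℝ}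
    (hP : Pcom ∈ CombinedMultipliers G 𝒟 Pj Pd)
    {Δ : Matrix (BlockIdx nw) (BlockIdx nz) ℝ} (hΔ : Δ ∈ DeltaCom G 𝒟 Pj Pd) (ξ : Fin n → ℝ) :
    0 ≤ Sum.elim ((G.Bw * Δ)ᵀ *ᵥ ξ) ξ ⬝ᵥ (Pcom *ᵥ Sum.elim ((G.Bw * Δ)ᵀ *ᵥ ξ) ξ) := by
  obtain ⟨_, ⟨P, hPmem, rfl⟩, _, ⟨Q, hQ, rfl⟩, rfl⟩ := hP
  obtain ⟨⟨Δj, rfl, hΔj⟩, D, hD, hM⟩ := hΔ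
  rw [Matrix.add_mulVec, dotProduct_add, Matrix.sum_mulVec, dotProduct_sum]
  refine add_nonneg (Finset.sum_nonneg fun j _ => ?_) ?_
  · rw [quadForm_conj]
    -- With `y = Bⱼᵀ ξ` the factor produces `(Δⱼᵀ y, y)`, the vector tested by the constraint on
    -- block `j`.
    have : G.priorFactor j *ᵥ Sum.elim ((G.Bw * Matrix.blockDiagonal' Δj)ᵀ *ᵥ ξ) ξ =
        Sum.elim ((Δj j)ᵀ *ᵥ ((G.Bw * blockCol nw j)ᵀ *ᵥ ξ)) ((G.Bw * blockCol nw j)ᵀ *ᵥ ξ) := by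
      rw [Plant.priorFactor, Matrix.fromBlocks_mulVec]
      simp only [Sum.elim_comp_inl, Sum.elim_comp_inr, Matrix.zero_mulVec, add_zero, Matrix.mulVec_mulVec,
        Matrix.transpose_mul, Matrix.zero_mul, zero_add]
      rw [← Matrix.mul_assoc, blockCol_transpose_mul, Matrix.mul_assoc]
    rw [this]
    exact (hΔj j _ (hPmem j)).nonneg _
  · rw [quadForm_conj]
    -- The transposed data equation gives `Mᵀ ξ - Zᵀ (Bw Δ)ᵀ ξ = Dᵀ Bdᵀ ξ`, so the constraint on `D`
    -- applies at `Bdᵀ ξ`.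
    have : G.dataFactor 𝒟 *ᵥ Sum.elim ((G.Bw * Matrix.blockDiagonal' Δj)ᵀ *ᵥ ξ) ξ =
        Sum.elim (Dᵀ *ᵥ (G.Bdᵀ *ᵥ ξ)) (G.Bdᵀ *ᵥ ξ) := by
      rw [Plant.dataFactor, Matrix.fromBlocks_mulVec]
      simp only [Sum.elim_comp_inl, Sum.elim_comp_inr, Matrix.mulVec_mulVec,
        ← Matrix.add_mulVec, Matrix.zero_mul, zero_add]
      congr 2
      rw [hM, Matrix.transpose_add, Matrix.transpose_mul _ (G.Z 𝒟), Matrix.transpose_mul G.Bd,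
        Matrix.neg_mul]
      abel
    rw [this]
    exact (hD _ hQ).nonneg _

end Synthesis

/-! ### From dual to primal dissipation -/

section Dissipation

variable {n m nd ne nwp nzp ℓ N : ℕ} {nw nz : Fin ℓ → ℕ}

/-- The dual dissipation inequality at one time step: `ζ` is the successor of the dual state `ξ`
under the dual input `v`, and it satisfies the duality relation with the primal step. -/
def Plant.DualDissipation (G : Plant n m nd ne nwp nzp nw nz) (Y : Matrix (Fin n) (Fin n) ℝ)
    (Pp : Matrix (Fin nd ⊕ Fin ne) (Fin nd ⊕ Fin ne) ℝ) (α : ℝ)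
    (x : Fin n → ℝ) (d : Fin nd → ℝ) (x' : Fin n → ℝ) (e : Fin ne → ℝ) : Prop :=
  ∀ (ξ : Fin n → ℝ) (v : Fin ne → ℝ), ∃ ζ : Fin n → ℝ,
    ζ ⬝ᵥ x + (G.Bdᵀ *ᵥ ξ + G.Dedᵀ *ᵥ v) ⬝ᵥ d = ξ ⬝ᵥ x' + v ⬝ᵥ e ∧
    ζ ⬝ᵥ (Y *ᵥ ζ) + α * (ξ ⬝ᵥ ξ + v ⬝ᵥ v) ≤ ξ ⬝ᵥ (Y *ᵥ ξ) +
      Sum.elim (G.Bdᵀ *ᵥ ξ + G.Dedᵀ *ᵥ v) (-v) ⬝ᵥ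
        (Pp⁻¹ *ᵥ Sum.elim (G.Bdᵀ *ᵥ ξ + G.Dedᵀ *ᵥ v) (-v))

/-- The dissipation inequality for the dual of the closed-loop system, with a margin that is
uniform in the uncertainties. -/
theorem exists_dual_dissipation {G : Plant n m nd ne nwp nzp nw nz}
    {Pj : ∀ j : Fin ℓ,
      ConvexCone ℝ (Matrix (Fin (nz j) ⊕ Fin (nw j)) (Fin (nz j) ⊕ Fin (nw j)) ℝ)}
    {Pd : ConvexCone ℝ (Matrix (Fin N ⊕ Fin nd) (Fin N ⊕ Fin nd) ℝ)}
    {Pnl : ConvexCone ℝ (Matrix (Fin nzp ⊕ Fin nwp) (Fin nzp ⊕ Fin nwp) ℝ)}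
    {𝒟 : Data n m nwp nzp N} {K : Matrix (Fin m) (Fin n) ℝ} {Y : Matrix (Fin n) (Fin n) ℝ}
    {Pcom : Matrix (BlockIdx nz ⊕ Fin n) (BlockIdx nz ⊕ Fin n) ℝ}
    (hPcom : Pcom ∈ CombinedMultipliers G 𝒟 Pj Pd)
    {Pn : Matrix (Fin nzp ⊕ Fin nwp) (Fin nzp ⊕ Fin nwp) ℝ} (hPn : Pn ∈ Pnl)
    {Pp : Matrix (Fin nd ⊕ Fin ne) (Fin nd ⊕ Fin ne) ℝ} (hPp : Pp.IsSymm)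
    (hLMI : G.SynthesisLMI K Y Pn Pcom Pp) :
    ∃ α, 0 < α ∧ ∀ Δ ∈ DeltaCom G 𝒟 Pj Pd, ∀ Δp ∈ NLSet n Pnl,
      ∀ (x : Fin n → ℝ) (d : Fin nd → ℝ) (x' : Fin n → ℝ) (e : Fin ne → ℝ),
      G.Step Δ Δp x (K *ᵥ x) d x' e →
      G.DualDissipation Y Pp α x d x' e := by
  obtain ⟨α, hα, h⟩ := hLMI.exists_margin
  refine ⟨α, hα, fun Δ hΔ Δp hΔp x d x' e hstep ξ v => ?_⟩
  obtain ⟨w, z, wp, zp, rfl, rfl, rfl, rfl, rfl, rfl⟩ := hstep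
  have h1 := CombinedMultipliers.nonneg hPcom hΔ ξ
  have h2 := (hΔp.2 Pn hPn x).nonneg (G.Bwpᵀ *ᵥ ξ + G.Dzwpᵀ *ᵥ ((G.Bw * Δ)ᵀ *ᵥ ξ))
  -- Choosing `η = (Bw Δ)ᵀ ξ` and `η' = Δ'(x)ᵀ μ` makes both multiplier terms the nonnegative
  -- quantities `h1` and `h2`.
  have h3 := h ξ ((Δp x)ᵀ *ᵥ (G.Bwpᵀ *ᵥ ξ + G.Dzwpᵀ *ᵥ ((G.Bw * Δ)ᵀ *ᵥ ξ)))
    ((G.Bw * Δ)ᵀ *ᵥ ξ) v _ _ _ rfl rfl rfl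
  rw [quadForm_dualIndex _ _ hPp] at h3
  refine ⟨_, ?_, by linarith⟩
  simp only [add_dotProduct, mulVec_dotProduct_eq, Matrix.transpose_transpose, Matrix.mulVec_add,
    Matrix.add_mulVec, ← Matrix.mulVec_mulVec, dotProduct_add]
  ring

theorem quadForm_inv_mulVec {ι : Type*} [Fintype ι] [DecidableEq ι] {Y : Matrix ι ι ℝ}
    (hY : IsUnit Y) (x : ι → ℝ) : (Y⁻¹ *ᵥ x) ⬝ᵥ (Y *ᵥ (Y⁻¹ *ᵥ x)) = x ⬝ᵥ (Y⁻¹ *ᵥ x) := by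
  rw [Matrix.mulVec_mulVec, Matrix.mul_nonsing_inv _ ((Matrix.isUnit_iff_isUnit_det _).1 hY),
    Matrix.one_mulVec, dotProduct_comm]

theorem mulVec_inv_mulVec {ι : Type*} [Fintype ι] [DecidableEq ι] {Y : Matrix ι ι ℝ}
    (hY : IsUnit Y) (x : ι → ℝ) : Y *ᵥ (Y⁻¹ *ᵥ x) = x := by
  rw [Matrix.mulVec_mulVec, Matrix.mul_nonsing_inv _ ((Matrix.isUnit_iff_isUnit_det _).1 hY),
    Matrix.one_mulVec]

theorem inv_mulVec_mulVec {ι : Type*} [Fintype ι] [DecidableEq ι] {Y : Matrix ι ι ℝ}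
    (hY : IsUnit Y) (x : ι → ℝ) : Y⁻¹ *ᵥ (Y *ᵥ x) = x := by
  rw [Matrix.mulVec_mulVec, Matrix.nonsing_inv_mul _ ((Matrix.isUnit_iff_isUnit_det _).1 hY),
    Matrix.one_mulVec]

theorem isSymm_inv {ι : Type*} [Fintype ι] [DecidableEq ι] {M : Matrix ι ι ℝ} (hM : M.IsSymm) :
    M⁻¹.IsSymm := by
  rw [Matrix.IsSymm, Matrix.transpose_nonsing_inv, hM.eq]

theorem toBlocks₁₁_quadForm {ι κ : Type*} [Fintype ι] [Fintype κ]
    (M : Matrix (ι ⊕ κ) (ι ⊕ κ) ℝ) (q : ι → ℝ) :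
    Sum.elim q 0 ⬝ᵥ (M *ᵥ Sum.elim q 0) = q ⬝ᵥ (M.toBlocks₁₁ *ᵥ q) := by
  conv_lhs => rw [← Matrix.fromBlocks_toBlocks M]
  rw [quadForm_fromBlocks]
  simp

/-- Decay of the storage function `x ↦ xᵀ Y⁻¹ x` up to an input-dependent term. -/
theorem exists_storage_decay {G : Plant n m nd ne nwp nzp nw nz}
    {Y : Matrix (Fin n) (Fin n) ℝ} (hY : Y.PosDef)
    {Pp : Matrix (Fin nd ⊕ Fin ne) (Fin nd ⊕ Fin ne) ℝ}
    (hQ : (-(Pp⁻¹).toBlocks₁₁).PosSemidef) {α : ℝ} (hα : 0 < α) :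
    ∃ θ c, 0 < θ ∧ θ < 1 ∧ 0 < c ∧
      ∀ (x : Fin n → ℝ) (d : Fin nd → ℝ) (x' : Fin n → ℝ) (e : Fin ne → ℝ),
      G.DualDissipation Y Pp α x d x' e →
      x' ⬝ᵥ (Y⁻¹ *ᵥ x') ≤ θ * (x ⬝ᵥ (Y⁻¹ *ᵥ x)) + c * (d ⬝ᵥ d) := by
  have hYs : Y.IsSymm := by
    simpa [Matrix.IsHermitian, Matrix.IsSymm] using hY.isHermitian
  obtain ⟨b, hb, hYb⟩ := exists_abs_quadForm_le Y
  obtain ⟨g, hg, hBd⟩ := exists_mulVec_sq_le G.Bd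
  refine ⟨(1 + α / b / 2)⁻¹, 2 * (g / α), by positivity, inv_lt_one_of_one_lt₀ (by
    have : 0 < α / b := by positivity
    linarith), by positivity, fun x d x' e hdual => ?_⟩
  -- With `v = 0` the performance term reduces to `qᵀ Q̃_p q ≤ 0`.
  obtain ⟨ζ, heq, hle⟩ := hdual (Y⁻¹ *ᵥ x') 0
  simp only [Matrix.mulVec_zero, add_zero, neg_zero, zero_dotProduct, toBlocks₁₁_quadForm] at heq hle
  have hq := posSemidef_quadForm_nonneg hQ (G.Bdᵀ *ᵥ (Y⁻¹ *ᵥ x'))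
  rw [Matrix.neg_mulVec, dotProduct_neg] at hq
  rw [quadForm_inv_mulVec hY.isUnit] at hle
  have hξ := (abs_le.1 (hYb (Y⁻¹ *ᵥ x'))).2
  rw [quadForm_inv_mulVec hY.isUnit] at hξ
  rw [dotProduct_comm _ x'] at heq
  -- Young's inequality in the metric of `Y`
  have hyoung := posSemidef_quadForm_nonneg hY.posSemidef (ζ - Y⁻¹ *ᵥ x)
  rw [Matrix.mulVec_sub, dotProduct_sub, sub_dotProduct, sub_dotProduct,
    symm_dotProduct_mulVec_comm hYs (Y⁻¹ *ᵥ x) ζ, quadForm_inv_mulVec hY.isUnit,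
    mulVec_inv_mulVec hY.isUnit] at hyoung
  -- The cross term enters doubled, so the weight `α / 4` spends half of the margin `α |ξ|²`; the
  -- other half, at least `α / (2 b) * V x'`, yields the contraction factor.
  have hd : (G.Bdᵀ *ᵥ (Y⁻¹ *ᵥ x')) ⬝ᵥ d ≤
      α / 4 * ((Y⁻¹ *ᵥ x') ⬝ᵥ (Y⁻¹ *ᵥ x')) + g / α * (d ⬝ᵥ d) := by
    rw [mulVec_dotProduct_eq, Matrix.transpose_transpose]
    set ξ := Y⁻¹ *ᵥ x'
    have h1 := dotProduct_self_nonneg ((α / 2) • ξ - G.Bd *ᵥ d)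
    have h2 := hBd d
    simp only [sub_dotProduct, dotProduct_sub, smul_dotProduct, dotProduct_smul, smul_eq_mul,
      dotProduct_comm (G.Bd *ᵥ d) ξ] at h1
    have h3 : α * (ξ ⬝ᵥ G.Bd *ᵥ d) ≤ α * (α / 4 * (ξ ⬝ᵥ ξ)) + g * (d ⬝ᵥ d) := by nlinarith
    have h4 : g * (d ⬝ᵥ d) = α * (g / α * (d ⬝ᵥ d)) := by field_simp
    rw [h4, ← mul_add] at h3
    exact le_of_mul_le_mul_left h3 hα
  set V' := x' ⬝ᵥ (Y⁻¹ *ᵥ x')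
  set V := x ⬝ᵥ (Y⁻¹ *ᵥ x)
  set s := (Y⁻¹ *ᵥ x') ⬝ᵥ (Y⁻¹ *ᵥ x')
  set D := d ⬝ᵥ d
  have hD : 0 ≤ D := dotProduct_self_nonneg d
  have hs : α / b * V' ≤ α * s := by
    rw [div_mul_eq_mul_div, div_le_iff₀ hb]
    nlinarith
  have hmain : (1 + α / b / 2) * V' ≤ V + 2 * (g / α) * D := by linarith
  have hpos : 0 < 1 + α / b / 2 := by positivity
  have hinv : (1 + α / b / 2)⁻¹ ≤ 1 := inv_le_one_of_one_le₀ (by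
    have : 0 < α / b := by positivity
    linarith)
  have hc : 0 ≤ 2 * (g / α) * D := by positivity
  calc V' ≤ (1 + α / b / 2)⁻¹ * (V + 2 * (g / α) * D) := by
        rwa [← div_eq_inv_mul, le_div_iff₀ hpos, mul_comm]
    _ ≤ (1 + α / b / 2)⁻¹ * V + 2 * (g / α) * D := by
        rw [mul_add]
        exact add_le_add_right (mul_le_of_le_one_left hc hinv) _

/-- The strict dissipation inequality with storage function `x ↦ xᵀ Y⁻¹ x`, obtained from the dual
one. -/
theorem exists_dissipation {G : Plant n m nd ne nwp nzp nw nz}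
    {Y : Matrix (Fin n) (Fin n) ℝ} (hY : Y.PosDef)
    {Pp : Matrix (Fin nd ⊕ Fin ne) (Fin nd ⊕ Fin ne) ℝ} (hPp : Pp.IsSymm) (hPu : IsUnit Pp)
    (hQ : (-(Pp⁻¹).toBlocks₁₁).PosSemidef) {α : ℝ} (hα : 0 < α) :
    ∃ ε, 0 < ε ∧ ∀ (x : Fin n → ℝ) (d : Fin nd → ℝ) (x' : Fin n → ℝ) (e : Fin ne → ℝ),
      G.DualDissipation Y Pp α x d x' e →
      x' ⬝ᵥ (Y⁻¹ *ᵥ x') - x ⬝ᵥ (Y⁻¹ *ᵥ x) + supply Pp d e ≤ -ε * (d ⬝ᵥ d) := by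
  have hYs : Y.IsSymm := by
    simpa [Matrix.IsHermitian, Matrix.IsSymm] using hY.isHermitian
  obtain ⟨c₁, hc₁, h₁⟩ := exists_mulVec_sq_le Pp⁻¹
  obtain ⟨c₂, hc₂, h₂⟩ := exists_mulVec_sq_le G.Bdᵀ
  obtain ⟨c₃, hc₃, h₃⟩ := exists_mulVec_sq_le G.Dedᵀ
  obtain ⟨c₄, hc₄, h₄⟩ := exists_mulVec_sq_le_quadForm hQ
  refine ⟨(2 * c₄ + 2 * c₁ * (2 * c₂ + 2 * c₃ + 1) / α)⁻¹, by positivity,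
    fun x d x' e hdual => ?_⟩
  set yd : Fin nd → ℝ := (Pp *ᵥ Sum.elim d e) ∘ Sum.inl with hyd
  set ye : Fin ne → ℝ := (Pp *ᵥ Sum.elim d e) ∘ Sum.inr with hye
  have hy : Pp *ᵥ Sum.elim d e = Sum.elim yd ye := (Sum.elim_comp_inl_inr _).symm
  have hinv : Pp⁻¹ *ᵥ Sum.elim yd ye = Sum.elim d e := by rw [← hy, inv_mulVec_mulVec hPu]
  -- The test pair is the pair of gradients, up to a factor 2, of storage at `x'` and of supply with
  -- respect to `e`.
  obtain ⟨ζ, heq, hle⟩ := hdual (Y⁻¹ *ᵥ x') ye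
  rw [quadForm_inv_mulVec hY.isUnit] at hle
  rw [dotProduct_comm _ x'] at heq
  set ξ := Y⁻¹ *ᵥ x' with hξ
  set q := G.Bdᵀ *ᵥ ξ + G.Dedᵀ *ᵥ ye with hq
  have hsq := posSemidef_quadForm_nonneg hY.posSemidef (ζ - Y⁻¹ *ᵥ x)
  rw [Matrix.mulVec_sub, dotProduct_sub, sub_dotProduct, sub_dotProduct,
    symm_dotProduct_mulVec_comm hYs (Y⁻¹ *ᵥ x) ζ, quadForm_inv_mulVec hY.isUnit,
    mulVec_inv_mulVec hY.isUnit] at hsq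
  -- The `e`-components cancel, so the form of `P_p⁻¹` at this sum sees only `Q̃_p`; its value `τ`
  -- is nonpositive.
  have hsplit : Sum.elim (yd + q) (0 : Fin ne → ℝ) = Sum.elim yd ye + Sum.elim q (-ye) := by
    rw [← Sum.elim_add_add, add_neg_cancel]
  have hsupply : supply Pp d e = Sum.elim yd ye ⬝ᵥ Sum.elim d e := by
    rw [supply, hy, dotProduct_comm]
  have hquad := toBlocks₁₁_quadForm Pp⁻¹ (yd + q)
  rw [hsplit, Matrix.mulVec_add, dotProduct_add, add_dotProduct, add_dotProduct,
    symm_dotProduct_mulVec_comm (isSymm_inv hPp) (Sum.elim yd ye) (Sum.elim q (-ye)), hinv,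
    ← hsupply, sumElim_dotProduct_sumElim, neg_dotProduct] at hquad
  -- The squares leave the slack `-τ + α (|ξ|² + |ye|²)`. To bound `|d|²` by it, `d` is split into a
  -- `Q̃_p` part, controlled by `-τ`, and a part linear in `ξ` and `ye`.
  have hdist : d = (Pp⁻¹).toBlocks₁₁ *ᵥ (yd + q) - (Pp⁻¹ *ᵥ Sum.elim q (-ye)) ∘ Sum.inl := by
    have h : (Pp⁻¹ *ᵥ Sum.elim (yd + q) (0 : Fin ne → ℝ)) ∘ Sum.inl =
        (Pp⁻¹).toBlocks₁₁ *ᵥ (yd + q) := by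
      conv_lhs => rw [← Matrix.fromBlocks_toBlocks Pp⁻¹]
      rw [Matrix.fromBlocks_mulVec]
      simp
    rw [← h, hsplit, Matrix.mulVec_add, hinv]
    ext i
    simp
  have hb₄ := h₄ (yd + q)
  simp only [Matrix.neg_mulVec, neg_dotProduct, dotProduct_neg, neg_neg] at hb₄
  have hb₁ := h₁ (Sum.elim q (-ye))
  rw [sumElim_dotProduct_sumElim, neg_dotProduct, dotProduct_neg, neg_neg] at hb₁
  have hb₂ := h₂ ξ
  have hb₃ := h₃ ye
  have hqq : q ⬝ᵥ q ≤ 2 * (c₂ * (ξ ⬝ᵥ ξ) + c₃ * (ye ⬝ᵥ ye)) := by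
    have := dotProduct_self_add_le (G.Bdᵀ *ᵥ ξ) (G.Dedᵀ *ᵥ ye)
    rw [← hq] at this
    linarith
  set p := Pp⁻¹ *ᵥ Sum.elim q (-ye) with hp
  have hpp : (p ∘ Sum.inl) ⬝ᵥ (p ∘ Sum.inl) ≤ p ⬝ᵥ p := by
    have h : p ⬝ᵥ p = (p ∘ Sum.inl) ⬝ᵥ (p ∘ Sum.inl) + (p ∘ Sum.inr) ⬝ᵥ (p ∘ Sum.inr) := by
      rw [← sumElim_dotProduct_sumElim, Sum.elim_comp_inl_inr]
    rw [h]
    linarith [dotProduct_self_nonneg (p ∘ Sum.inr)]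
  have hdd := dotProduct_self_add_le ((Pp⁻¹).toBlocks₁₁ *ᵥ (yd + q)) (-(p ∘ Sum.inl))
  rw [← sub_eq_add_neg, ← hdist, neg_dotProduct, dotProduct_neg, neg_neg] at hdd
  have hneg := posSemidef_quadForm_nonneg hQ (yd + q)
  rw [Matrix.neg_mulVec, dotProduct_neg] at hneg
  have hX := dotProduct_self_nonneg ξ
  have hE := dotProduct_self_nonneg ye
  set τ := (yd + q) ⬝ᵥ ((Pp⁻¹).toBlocks₁₁ *ᵥ (yd + q))
  have hbound : d ⬝ᵥ d ≤ (2 * c₄ + 2 * c₁ * (2 * c₂ + 2 * c₃ + 1) / α) *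
      (-τ + α * (ξ ⬝ᵥ ξ + ye ⬝ᵥ ye)) := by
    have hb : d ⬝ᵥ d ≤ 2 * (c₄ * (-τ)) +
        2 * (c₁ * (2 * (c₂ * (ξ ⬝ᵥ ξ) + c₃ * (ye ⬝ᵥ ye)) + ye ⬝ᵥ ye)) := by
      have := mul_le_mul_of_nonneg_left (add_le_add_left hqq (ye ⬝ᵥ ye)) hc₁.le
      linarith
    -- Expanding the product gives the required bound plus cross terms that are all nonnegative.
    have hexp : (2 * c₄ + 2 * c₁ * (2 * c₂ + 2 * c₃ + 1) / α) *
        (-τ + α * (ξ ⬝ᵥ ξ + ye ⬝ᵥ ye)) = 2 * (c₄ * (-τ)) +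
        2 * (c₁ * (2 * (c₂ * (ξ ⬝ᵥ ξ) + c₃ * (ye ⬝ᵥ ye)) + ye ⬝ᵥ ye)) +
        (2 * c₄ * α * (ξ ⬝ᵥ ξ + ye ⬝ᵥ ye) + 2 * c₁ * (2 * c₂ + 2 * c₃ + 1) / α * (-τ) +
          2 * c₁ * (2 * c₂ * (ye ⬝ᵥ ye) + 2 * c₃ * (ξ ⬝ᵥ ξ) + ξ ⬝ᵥ ξ)) := by
      field_simp
      ring
    rw [hexp]
    have : 0 ≤ 2 * c₄ * α * (ξ ⬝ᵥ ξ + ye ⬝ᵥ ye) +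
        2 * c₁ * (2 * c₂ + 2 * c₃ + 1) / α * (-τ) +
          2 * c₁ * (2 * c₂ * (ye ⬝ᵥ ye) + 2 * c₃ * (ξ ⬝ᵥ ξ) + ξ ⬝ᵥ ξ) := by positivity
    exact hb.trans (le_add_of_nonneg_right this)
  have hε := (inv_mul_le_iff₀ (by positivity)).2 hbound
  clear hbound
  generalize (2 * c₄ + 2 * c₁ * (2 * c₂ + 2 * c₃ + 1) / α)⁻¹ = ε at hε ⊢
  linarith

end Dissipation

/-! ### Decay, summability and the supply rate along trajectories -/

section Conclusion

variable {n m nd ne nwp nzp ℓ N : ℕ} {nw nz : Fin ℓ → ℕ}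

/-- Summing the recursion and shifting the index gives `(1 - θ) ∑ V ≤ V 0 + c ∑ D` for every partial
sum. -/
theorem summable_of_le_mul_add {V D : ℕ → ℝ} {θ c : ℝ} (hθ : θ < 1) (hc : 0 ≤ c)
    (hV : ∀ k, 0 ≤ V k) (hD : ∀ k, 0 ≤ D k) (hDs : Summable D)
    (h : ∀ k, V (k + 1) ≤ θ * V k + c * D k) : Summable V := by
  refine summable_of_sum_range_le (c := (V 0 + c * ∑' k, D k) / (1 - θ)) hV fun N => ?_
  rw [le_div_iff₀ (by linarith)]
  have h1 : ∑ k ∈ Finset.range N, V (k + 1) ≤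
      θ * ∑ k ∈ Finset.range N, V k + c * ∑ k ∈ Finset.range N, D k := by
    rw [Finset.mul_sum, Finset.mul_sum, ← Finset.sum_add_distrib]
    exact Finset.sum_le_sum fun k _ => h k
  have h2 := (Finset.sum_range_succ V N).symm.trans (Finset.sum_range_succ' V N)
  have h3 := mul_le_mul_of_nonneg_left (hDs.sum_le_tsum (Finset.range N) fun k _ => hD k) hc
  linarith [hV N]

theorem norm_toLp_sq (v : Fin n → ℝ) : ‖WithLp.toLp 2 v‖ ^ 2 = v ⬝ᵥ v := by
  rw [EuclideanSpace.real_norm_sq_eq, dotProduct]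
  exact Finset.sum_congr rfl fun i _ => pow_two _

theorem norm_le_of_storage_decay {X : Matrix (Fin n) (Fin n) ℝ} {a b θ : ℝ} (ha : 0 < a)
    (hb : 0 < b) (hθ : 0 ≤ θ) (hlow : ∀ v, a * (v ⬝ᵥ v) ≤ v ⬝ᵥ (X *ᵥ v))
    (hup : ∀ v, v ⬝ᵥ (X *ᵥ v) ≤ b * (v ⬝ᵥ v)) {x : ℕ → Fin n → ℝ}
    (h : ∀ k, x (k + 1) ⬝ᵥ (X *ᵥ x (k + 1)) ≤ θ * (x k ⬝ᵥ (X *ᵥ x k))) (k : ℕ) :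
    ‖WithLp.toLp 2 (x k)‖ ≤ √(b / a) * √θ ^ k * ‖WithLp.toLp 2 (x 0)‖ := by
  have hV : ∀ k, x k ⬝ᵥ (X *ᵥ x k) ≤ θ ^ k * (x 0 ⬝ᵥ (X *ᵥ x 0)) := by
    intro k
    induction k with
    | zero => simp
    | succ k ih =>
      refine (h k).trans ?_
      rw [pow_succ', mul_assoc]
      exact mul_le_mul_of_nonneg_left ih hθ
  refine le_of_sq_le_sq ?_ (by positivity)
  rw [mul_pow, mul_pow, ← pow_mul, mul_comm k 2, pow_mul, Real.sq_sqrt (by positivity),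
    Real.sq_sqrt hθ, norm_toLp_sq, norm_toLp_sq]
  have h1 : a * (x k ⬝ᵥ x k) ≤ θ ^ k * (b * (x 0 ⬝ᵥ x 0)) :=
    ((hlow _).trans (hV k)).trans (mul_le_mul_of_nonneg_left (hup _) (by positivity))
  rw [div_mul_eq_mul_div, div_mul_eq_mul_div, le_div_iff₀ ha]
  linarith

/-- `P_p` may be indefinite, so convergence of the supply series needs domination. The output `e`
depends on `x` and `d` only, hence the constant is independent of the uncertainties. -/
theorem Plant.Step.exists_abs_supply_le (G : Plant n m nd ne nwp nzp nw nz)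
    (K : Matrix (Fin m) (Fin n) ℝ) (Pp : Matrix (Fin nd ⊕ Fin ne) (Fin nd ⊕ Fin ne) ℝ) :
    ∃ c, 0 < c ∧ ∀ (Δ : Matrix (BlockIdx nw) (BlockIdx nz) ℝ) (Δp : NLUncertainty n nwp nzp)
      (x : Fin n → ℝ) (d : Fin nd → ℝ) (x' : Fin n → ℝ) (e : Fin ne → ℝ),
      G.Step Δ Δp x (K *ᵥ x) d x' e → |supply Pp d e| ≤ c * (x ⬝ᵥ x + d ⬝ᵥ d) := by
  obtain ⟨c₁, hc₁, h₁⟩ := exists_abs_quadForm_le Pp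
  obtain ⟨c₂, hc₂, h₂⟩ := exists_mulVec_sq_le (G.Ce + G.Deu * K)
  obtain ⟨c₃, hc₃, h₃⟩ := exists_mulVec_sq_le G.Ded
  refine ⟨c₁ * (1 + 2 * c₂ + 2 * c₃), by positivity, fun Δ Δp x d x' e hstep => ?_⟩
  obtain ⟨-, -, -, -, -, he, -⟩ := hstep
  have he' : e = (G.Ce + G.Deu * K) *ᵥ x + G.Ded *ᵥ d := by
    rw [he, Matrix.add_mulVec, Matrix.mulVec_mulVec]
  have h4 := dotProduct_self_add_le ((G.Ce + G.Deu * K) *ᵥ x) (G.Ded *ᵥ d)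
  rw [← he'] at h4
  refine (h₁ _).trans ?_
  rw [sumElim_dotProduct_sumElim, mul_assoc]
  refine mul_le_mul_of_nonneg_left ?_ hc₁.le
  nlinarith [h₂ x, h₃ d, dotProduct_self_nonneg x, dotProduct_self_nonneg d]

end Conclusion

end RobustPerf

theorem theorem2 {n m nd ne nwp nzp ℓ N : ℕ} {nw nz : Fin ℓ → ℕ}
    -- the known part of the system
    (G : RobustPerf.Plant n m nd ne nwp nzp nw nz)
    -- the multiplier classes for the blocks of the parametric uncertainty
    (Pj : ∀ j : Fin ℓ,
      ConvexCone ℝ (Matrix (Fin (nz j) ⊕ Fin (nw j)) (Fin (nz j) ⊕ Fin (nw j)) ℝ))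
    (hPj : ∀ j, RobustPerf.IsMultiplierClass (Pj j))
    (hPj_neg : ∀ j, RobustPerf.HasNegDefBlock (Pj j))
    -- the multiplier class for the disturbance in the data
    (Pd : ConvexCone ℝ (Matrix (Fin N ⊕ Fin nd) (Fin N ⊕ Fin nd) ℝ))
    (hPd : RobustPerf.IsMultiplierClass Pd)
    (hPd_neg : RobustPerf.HasNegDefBlock Pd)
    -- the multiplier class for the nonlinear uncertainty
    (Pnl : ConvexCone ℝ (Matrix (Fin nzp ⊕ Fin nwp) (Fin nzp ⊕ Fin nwp) ℝ))
    (hPnl : RobustPerf.IsMultiplierClass Pnl)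
    -- the data, generated by the true uncertainties and the true disturbance
    (𝒟 : RobustPerf.Data n m nwp nzp N)
    (Δtr : Matrix (RobustPerf.BlockIdx nw) (RobustPerf.BlockIdx nz) ℝ)
    (hΔtr : Δtr ∈ RobustPerf.DeltaPrior Pj)
    (Dtr : Matrix (Fin nd) (Fin N) ℝ) (hDtr : Dtr ∈ RobustPerf.DisturbanceSet Pd)
    (Δptr : RobustPerf.NLUncertainty n nwp nzp) (hΔptr : Δptr ∈ RobustPerf.NLSet n Pnl)
    (hdata : 𝒟.GeneratedBy G Δtr Δptr Dtr)
    -- the performance index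
    (Qp : Matrix (Fin nd) (Fin nd) ℝ) (Sp : Matrix (Fin nd) (Fin ne) ℝ)
    (Rp : Matrix (Fin ne) (Fin ne) ℝ) (hQp : Qp.IsSymm) (hRp : Rp.IsSymm)
    (hPp : IsUnit (Matrix.fromBlocks Qp Sp Spᵀ Rp))
    (hQtilde : (-((Matrix.fromBlocks Qp Sp Spᵀ Rp)⁻¹).toBlocks₁₁).PosSemidef)
    -- feasibility of the synthesis inequality
    (Y : Matrix (Fin n) (Fin n) ℝ) (hY : Y.PosDef)
    (K : Matrix (Fin m) (Fin n) ℝ)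
    (Pcom : Matrix (RobustPerf.BlockIdx nz ⊕ Fin n) (RobustPerf.BlockIdx nz ⊕ Fin n) ℝ)
    (hPcom : Pcom ∈ RobustPerf.CombinedMultipliers G 𝒟 Pj Pd)
    (Pn : Matrix (Fin nzp ⊕ Fin nwp) (Fin nzp ⊕ Fin nwp) ℝ) (hPn : Pn ∈ Pnl)
    (hLMI : G.SynthesisLMI K Y Pn Pcom (Matrix.fromBlocks Qp Sp Spᵀ Rp)) :
    G.RobustlyStable K (RobustPerf.DeltaCom G 𝒟 Pj Pd) (RobustPerf.NLSet n Pnl) ∧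
      G.RobustQuadPerf K (RobustPerf.DeltaCom G 𝒟 Pj Pd) (RobustPerf.NLSet n Pnl)
        (Matrix.fromBlocks Qp Sp Spᵀ Rp) := by
  have hsymm : (Matrix.fromBlocks Qp Sp Spᵀ Rp).IsSymm := by
    rw [Matrix.IsSymm, Matrix.fromBlocks_transpose, hQp.eq, hRp.eq, Matrix.transpose_transpose]
  obtain ⟨α, hα, hdual⟩ := RobustPerf.exists_dual_dissipation hPcom hPn hsymm hLMI
  obtain ⟨θ, c, hθ0, hθ1, hc, hdecay⟩ :=
    RobustPerf.exists_storage_decay (G := G) hY hQtilde hα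
  obtain ⟨a, ha, hlow⟩ := RobustPerf.exists_le_quadForm hY.inv
  constructor
  · obtain ⟨b, hb, hup⟩ := RobustPerf.exists_abs_quadForm_le Y⁻¹
    refine ⟨√(b / a), √θ, by positivity, by positivity, (Real.sqrt_lt' one_pos).2 (by simpa),
      fun Δ hΔ Δp hΔp x e hx => ?_⟩
    refine RobustPerf.norm_le_of_storage_decay ha hb hθ0.le hlow
      (fun v => (abs_le.1 (hup v)).2) fun k => ?_
    simpa using hdecay _ _ _ _ (hdual Δ hΔ Δp hΔp _ _ _ _ (hx k))
  · obtain ⟨ε, hε, hdiss⟩ := RobustPerf.exists_dissipation (G := G) hY hsymm hPp hQtilde hα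
    obtain ⟨s, hs, hsupply⟩ := RobustPerf.Plant.Step.exists_abs_supply_le G K
      (Matrix.fromBlocks Qp Sp Spᵀ Rp)
    refine ⟨ε, hε, fun d hd Δ hΔ Δp hΔp x e hx hx0 => ?_⟩
    have hV0 : ∀ k, 0 ≤ x k ⬝ᵥ (Y⁻¹ *ᵥ x k) := fun k =>
      RobustPerf.posSemidef_quadForm_nonneg hY.inv.posSemidef _
    have hV : Summable fun k => x k ⬝ᵥ (Y⁻¹ *ᵥ x k) :=
      RobustPerf.summable_of_le_mul_add hθ1 hc.le hV0
        (fun k => RobustPerf.dotProduct_self_nonneg (d k)) hd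
        fun k => hdecay _ _ _ _ (hdual Δ hΔ Δp hΔp _ _ _ _ (hx k))
    have hxs : Summable fun k => x k ⬝ᵥ x k :=
      (hV.mul_left a⁻¹).of_nonneg_of_le (fun k => RobustPerf.dotProduct_self_nonneg _)
        fun k => by rw [← div_eq_inv_mul, le_div_iff₀ ha, mul_comm]; exact hlow _
    have hsum : Summable fun k =>
        RobustPerf.supply (Matrix.fromBlocks Qp Sp Spᵀ Rp) (d k) (e k) :=
      ((hxs.add hd).mul_left s).of_norm_bounded fun k => hsupply _ _ _ _ _ _ (hx k)
    refine ⟨hsum, ?_⟩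
    -- The bound is proved for partial sums, where `V (x 0) = 0` and the final storage term is
    -- nonnegative, and then passes to the limit.
    refine le_of_tendsto_of_tendsto' hsum.hasSum.tendsto_sum_nat
      (hd.hasSum.tendsto_sum_nat.const_mul (-ε)) fun N => ?_
    have htel : ∀ N, ∑ k ∈ Finset.range N,
        RobustPerf.supply (Matrix.fromBlocks Qp Sp Spᵀ Rp) (d k) (e k) ≤
        -ε * ∑ k ∈ Finset.range N, d k ⬝ᵥ d k - x N ⬝ᵥ (Y⁻¹ *ᵥ x N) := by
      intro N
      induction N with
      | zero => simp [hx0]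
      | succ N ih =>
        rw [Finset.sum_range_succ, Finset.sum_range_succ, mul_add]
        linarith [hdiss _ _ _ _ (hdual Δ hΔ Δp hΔp _ _ _ _ (hx N))]
    linarith [htel N, hV0 N]
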